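/- Let $N,d$ be natural numbers, let $A_1,\dots,A_N\subseteq\mathbb{R}^d$ be closed and convex, let $J_1,\dots,J_N:\mathbb{R}^{Nd}\to\mathbb{R}$ be differentiable, and put $\boldsymbol A=A_1\times\dots\times A_N$. Write $\boldsymbol a=(\boldsymbol a^1,\dots,\boldsymbol a^N)$ with $\boldsymbol a^i\in\mathbb{R}^d$ for the vectors of $\mathbb{R}^{Nd}$; all norms and inner products are Euclidean. The game mapping is $\boldsymbol M=(\boldsymbol M_1,\dots,\boldsymbol M_N):\mathbb{R}^{Nd}\to\mathbb{R}^{Nd}$, $\boldsymbol M_i(\boldsymbol a)=\nabla_{\boldsymbol a^i}J_i(\boldsymbol a)$. Assume: 1. $(\boldsymbol M(\boldsymbol a)-\boldsymbol M(\boldsymbol b),\boldsymbol a-\boldsymbol b)\ge 0$ for all $\boldsymbol a,\boldsymbol b\in\boldsymbol A$. 2. There is $\boldsymbol a^*\in\boldsymbol A$ with $(\boldsymbol M(\boldsymbol a^*),\boldsymbol a-\boldsymbol a^*)\ge 0$ for all $\boldsymbol a\in\boldsymbol A$. 3. Each $\boldsymbol M_i$ is Lipschitz continuous on $\mathbb{R}^{Nd}$.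 4. For each $i$ there are constants $K,Q$ such that $|J_i(\boldsymbol a)|\le K(1+\|\boldsymbol a\|)$ whenever $\|\boldsymbol a\|\ge Q$. 5. $\gamma(t)=t^{-a}$, $\sigma(t)=t^{-b}$, $\epsilon(t)=t^{-c}$ for all integers $t\ge 1$, with $a,b,c>0$, while $\gamma(0),\sigma(0),\epsilon(0)$ are arbitrary positive numbers; and, with $\beta(t)=\gamma(t)\sigma^2(t)$, $\sum_{t\ge0}\beta(t)=\infty$, $\lim_{t\to\infty}\epsilon(t)=0$, $\sum_{t\ge1}\bigl(1+\frac1{\beta(t)\epsilon(t)}\bigr)\frac{|\epsilon(t-1)-\epsilon(t)|^2}{\epsilon^2(t)}<\infty$, $\sum_{t\ge0}\gamma^2(t)<\infty$, $\sum_{t\ge0}\beta(t)\sigma(t)<\infty$, $\lim_{t\to\infty}\sigma(t)=0$, $\sum_{t\ge0}\beta(t)\epsilon(t)=\infty$. Let $\mathbf{x}(t),\boldsymbol\mu(t)$, $t=0,1,2,\dots$, be random vectors in $\mathbb{R}^{Nd}$ on a probability space such that $\boldsymbol\mu(0)$ is an arbitrary deterministic vector; for each $t$ the conditional distribution of $\mathbf{x}(t)$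 given $\mathbf{x}(k)$, $k<t$, and $\boldsymbol\mu(k)$, $k\le t$, is the normal distribution with mean $\boldsymbol\mu(t)$ and covariance matrix $\sigma^2(t)I$; and for each $t\ge 0$ and $i$ $$\boldsymbol\mu^i(t+1)=\mathrm{Proj}_{A_i}\Bigl[\boldsymbol\mu^i(t)-\gamma(t)\sigma^2(t)\Bigl(J_i(\mathbf{x}(t))\,\frac{\mathbf{x}^i(t)-\boldsymbol\mu^i(t)}{\sigma^2(t)}+\epsilon(t)\boldsymbol\mu^i(t)\Bigr)\Bigr],$$ where $\mathrm{Proj}_{A_i}$ is the Euclidean projection on $A_i$. Then $$\Pr\Bigl\{\sup_{t\ge0}\|\boldsymbol\mu(t)\|<\infty\Bigr\}=1 .$$ -/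

import Mathlib

open MeasureTheory ProbabilityTheory Filter Topology

noncomputable section

/-- `ℝ^d` with the Euclidean norm: the space containing the action set of one player. -/
abbrev ActionSpace (d : ℕ) : Type := EuclideanSpace ℝ (Fin d)

/-- `ℝ^{Nd}` with the Euclidean norm: joint actions; the coordinate `(i, k)` is the `k`-th
coordinate of the action of player `i`. -/
abbrev JointSpace (N d : ℕ) : Type := EuclideanSpace ℝ (Fin N × Fin d)

/-- The component `a^i ∈ ℝ^d` of player `i` in the joint vector `a ∈ ℝ^{Nd}`. -/
def block {N d : ℕ} (a : JointSpace N d) (i : Fin N) : ActionSpace d :=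
  WithLp.toLp 2 (fun k => a (i, k))

/-- A game with `N` players, action sets `A i ⊆ ℝ^d` and cost functions `J i : ℝ^{Nd} → ℝ`. -/
structure ContinuousGame (N d : ℕ) where
  /-- the action sets -/
  A : Fin N → Set (ActionSpace d)
  /-- the cost functions -/
  J : Fin N → JointSpace N d → ℝ

namespace ContinuousGame

variable {N d : ℕ}

/-- The set `A_1 × ⋯ × A_N` of joint actions. -/
def jointActions (G : ContinuousGame N d) : Set (JointSpace N d) :=
  {a | ∀ i, block a i ∈ G.A i}

/-- The game mapping `M`, with coordinates `M_{i,k}(a) = ∂J_i(a)/∂a^i_k`. -/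
def gameMapping (G : ContinuousGame N d) (a : JointSpace N d) : JointSpace N d :=
  WithLp.toLp 2 (fun p => fderiv ℝ (G.J p.1) a (EuclideanSpace.single p 1))

end ContinuousGame

/-- `T` is monotone over `X`. -/
def MonotoneMappingOn {n : Type*} [Fintype n]
    (T : EuclideanSpace ℝ n → EuclideanSpace ℝ n) (X : Set (EuclideanSpace ℝ n)) : Prop :=
  ∀ x ∈ X, ∀ y ∈ X, 0 ≤ inner ℝ (T x - T y) (x - y)

/-- The solution set `SOL(Y, T)` of the variational inequality `VI(Y, T)`. -/
def viSolutions {n : Type*} [Fintype n]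
    (Y : Set (EuclideanSpace ℝ n)) (T : EuclideanSpace ℝ n → EuclideanSpace ℝ n) :
    Set (EuclideanSpace ℝ n) :=
  {y | y ∈ Y ∧ ∀ z ∈ Y, 0 ≤ inner ℝ (T y) (z - y)}

/-- `|f|` grows not faster than a linear function of the norm as the argument tends to infinity. -/
def GrowsAtMostLinearly {n : Type*} [Fintype n] (f : EuclideanSpace ℝ n → ℝ) : Prop :=
  ∃ K Q : ℝ, ∀ a, Q ≤ ‖a‖ → |f a| ≤ K * (1 + ‖a‖)

/-- `v` is the Euclidean projection of `u` on `C` (it exists and is unique if `C` is nonempty,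
closed and convex). -/
def IsProjection {d : ℕ} (C : Set (ActionSpace d)) (u v : ActionSpace d) : Prop :=
  v ∈ C ∧ ∀ w ∈ C, ‖u - v‖ ≤ ‖u - w‖

/-- The conditions on the step size `γ(t) = t^{-a}`, the standard deviation `σ(t) = t^{-b}` and
the regularization parameter `ε(t) = t^{-c}`, with `β(t) = γ(t) σ(t)^2`. As `t^{-a}` makes no sense
at `t = 0`, the values at `t = 0` are arbitrary positive numbers. -/
structure StepSizeConditions (a b c : ℝ) (γ σ ε : ℕ → ℝ) : Prop where
  a_pos : 0 < a
  b_pos : 0 < b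
  c_pos : 0 < c
  gamma_zero_pos : 0 < γ 0
  sigma_zero_pos : 0 < σ 0
  eps_zero_pos : 0 < ε 0
  gamma_eq : ∀ t : ℕ, 1 ≤ t → γ t = 1 / (t : ℝ) ^ a
  sigma_eq : ∀ t : ℕ, 1 ≤ t → σ t = 1 / (t : ℝ) ^ b
  eps_eq : ∀ t : ℕ, 1 ≤ t → ε t = 1 / (t : ℝ) ^ c
  sum_beta : Tendsto (fun n => ∑ t ∈ Finset.range n, γ t * σ t ^ 2) atTop atTop
  tendsto_eps : Tendsto ε atTop (𝓝 0)
  summable_eps_variation : Summable (fun t : ℕ =>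
    (1 + 1 / (γ (t + 1) * σ (t + 1) ^ 2 * ε (t + 1))) *
      (|ε t - ε (t + 1)| ^ 2 / ε (t + 1) ^ 2))
  summable_gamma_sq : Summable (fun t => γ t ^ 2)
  summable_beta_sigma : Summable (fun t => γ t * σ t ^ 2 * σ t)
  tendsto_sigma : Tendsto σ atTop (𝓝 0)
  sum_beta_eps : Tendsto (fun n => ∑ t ∈ Finset.range n, γ t * σ t ^ 2 * ε t) atTop atTop

/-- The normal distribution on `ℝ^{Nd}` with mean `m` and covariance matrix `s^2 I`: the
coordinates are independent, and the coordinate `p` has the law `N(m p, s^2)`. -/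
def isotropicGaussian {N d : ℕ} (m : JointSpace N d) (s : ℝ) : Measure (JointSpace N d) :=
  (Measure.pi (fun p => gaussianReal (m p) (s ^ 2).toNNReal)).map (WithLp.toLp 2)

/-- The information available just before the states at time `t` are drawn: the σ-algebra generated
by `x(k)`, `k < t`, and `μ(k)`, `k ≤ t`. -/
abbrev history {N d : ℕ} {Ω : Type*} (x μ : ℕ → Ω → JointSpace N d) (t : ℕ) : MeasurableSpace Ω :=
  (⨆ k, ⨆ _ : k < t, MeasurableSpace.comap (x k) inferInstance) ⊔
    (⨆ k, ⨆ _ : k ≤ t, MeasurableSpace.comap (μ k) inferInstance)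

/-- The random sequences `x(t)` (states) and `μ(t)` (means) on the probability space `(Ω, P)` form a
run of the regularized payoff-based algorithm started at `μ(0) = μ₀`. -/
structure IsPayoffBasedRun {N d : ℕ} (G : ContinuousGame N d) (γ σ ε : ℕ → ℝ)
    (μ₀ : JointSpace N d) {Ω : Type*} [MeasurableSpace Ω] (P : Measure Ω)
    (x μ : ℕ → Ω → JointSpace N d) : Prop where
  measurable_state : ∀ t, Measurable (x t)
  measurable_mean : ∀ t, Measurable (μ t)
  init : ∀ ω, μ 0 ω = μ₀
  /-- Given the past, the joint state `x(t)` has the law `N(μ(t), σ(t)^2 I)`. -/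
  state_law : ∀ t, ∀ B : Set (JointSpace N d), MeasurableSet B →
    P⟦x t ⁻¹' B | history x μ t⟧ =ᵐ[P] fun ω => (isotropicGaussian (μ t ω) (σ t)).real B
  /-- The update of the mean of player `i`, who observes the value `J_i(x(t))` only. -/
  update : ∀ t ω i, IsProjection (G.A i)
    (block (μ t ω) i - (γ t * σ t ^ 2) •
      (G.J i (x t ω) • ((σ t ^ 2)⁻¹ • (block (x t ω) i - block (μ t ω) i))
        + ε t • block (μ t ω) i))
    (block (μ (t + 1) ω) i)

end

/-! Let `a` solve the variational inequality and let `q m` be the part of `m - a` beyond the ball of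
radius `‖a‖` around `a`, so that `‖q m‖` is the distance from `m` to this ball. The Lyapunov
function is `1 + ‖q m‖ ^ 2`. Two drift terms have a favourable sign. Monotonicity and the
variational inequality give `⟪M m, m - a⟫ ≥ 0` for joint actions `m`. The sphere around `a` passes
through the origin, so `⟪m, m - a⟫ ≥ 0` outside the ball. This is why distances are measured to a
ball: with the distance to `a` itself, the regularization could cost a term of order `β ε`, which is
not summable. What remains is the bias of the payoff-based gradient estimate, of order `γ σ ^ 3 = β
σ` (`abs_integral_mul_inner_sub_le`), and second-order terms of order `γ ^ 2 * (1 + ‖m‖ ^ 2)`. Both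
weights are summable, so in conditional mean the Lyapunov function grows at most by factors `1 + θ
t` with `∑ θ t < ∞` (`excess_expansion_le`). Such a process is almost surely bounded
(`ae_bddAbove_of_setLIntegral_succ_le`). The conditioning is carried out by
`IsPayoffBasedRun.setLIntegral_eq`. -/

/-! ### Blocks and Euclidean projections -/

theorem block_sub {N d : ℕ} (a b : JointSpace N d) (i : Fin N) :
    block (a - b) i = block a i - block b i := rfl

theorem norm_sq_eq_sum_norm_block_sq {N d : ℕ} (a : JointSpace N d) :
    ‖a‖ ^ 2 = ∑ i, ‖block a i‖ ^ 2 := by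
  simp [EuclideanSpace.norm_sq_eq, Fintype.sum_prod_type, block]

/-- Moving to the projection on a convex set does not increase the distance to its points. -/
theorem IsProjection.norm_sub_le {d : ℕ} {C : Set (ActionSpace d)} (hC : Convex ℝ C)
    {u v w : ActionSpace d} (h : IsProjection C u v) (hw : w ∈ C) : ‖v - w‖ ≤ ‖u - w‖ := by
  have hinf : ‖u - v‖ = ⨅ z : C, ‖u - z‖ := by
    have : Nonempty C := ⟨⟨v, h.1⟩⟩
    refine le_antisymm (le_ciInf fun z => h.2 z z.2) ?_
    exact ciInf_le (f := fun z : C => ‖u - z‖)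
      ⟨0, by rintro _ ⟨z, rfl⟩; exact norm_nonneg _⟩ ⟨v, h.1⟩
  have hin := (norm_eq_iInf_iff_real_inner_le_zero hC h.1).1 hinf w hw
  have hexp : ‖u - w‖ ^ 2 = ‖u - v‖ ^ 2 - 2 * inner ℝ (u - v) (w - v) + ‖w - v‖ ^ 2 := by
    rw [← norm_sub_sq_real]; congr 2; abel
  rw [norm_sub_rev v w]
  refine le_of_sq_le_sq ?_ (norm_nonneg _)
  nlinarith [sq_nonneg ‖u - v‖]

/-! ### Radial retraction onto a ball -/

/-- The part of `m - a` that sticks out of the ball of radius `R` around `a`, as a fraction of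
`m - a`. -/
noncomputable def excessFraction {E : Type*} [NormedAddCommGroup E] (a : E) (R : ℝ) (m : E) : ℝ :=
  max (‖m - a‖ - R) 0 / ‖m - a‖

section excess
variable {E : Type*} [NormedAddCommGroup E] {a : E} {R : ℝ}

theorem excessFraction_nonneg (m : E) : 0 ≤ excessFraction a R m := by
  unfold excessFraction; positivity

theorem excessFraction_le_one (hR : 0 ≤ R) (m : E) : excessFraction a R m ≤ 1 := by
  unfold excessFraction
  exact div_le_one_of_le₀ (max_le (by linarith) (norm_nonneg _)) (norm_nonneg _)

theorem excessFraction_mul_norm (hR : 0 ≤ R) (m : E) :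
    excessFraction a R m * ‖m - a‖ = max (‖m - a‖ - R) 0 := by
  unfold excessFraction
  -- At `m = a` the fraction is `0 / 0 = 0`, which is the right value because `R ≥ 0`.
  rcases eq_or_ne ‖m - a‖ 0 with h | h
  · rw [h]; simp [hR]
  · rw [div_mul_cancel₀ _ h]

theorem excessFraction_eq_zero {m : E} (h : ‖m - a‖ ≤ R) : excessFraction a R m = 0 := by
  unfold excessFraction
  rw [max_eq_right (by linarith), zero_div]

variable [NormedSpace ℝ E]

/-- The radial retraction `m - excessFraction a R m • (m - a)` takes values in the ball. -/
theorem norm_retraction_sub_le (hR : 0 ≤ R) (m : E) :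
    ‖m - excessFraction a R m • (m - a) - a‖ ≤ R := by
  have h : m - excessFraction a R m • (m - a) - a = (1 - excessFraction a R m) • (m - a) := by
    module
  rw [h, norm_smul, Real.norm_of_nonneg (by linarith [excessFraction_le_one (a := a) hR m]),
    sub_mul, excessFraction_mul_norm hR]
  linarith [le_max_left (‖m - a‖ - R) 0]

/-- The retraction moves `m` along the segment towards `a`. -/
theorem retraction_mem {A : Set E} (hA : Convex ℝ A) (hR : 0 ≤ R) (ha : a ∈ A) {m : E}
    (hm : m ∈ A) : m - excessFraction a R m • (m - a) ∈ A := by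
  have h := hA hm ha (a := 1 - excessFraction a R m) (b := excessFraction a R m)
    (by linarith [excessFraction_le_one (a := a) hR m]) (excessFraction_nonneg m) (by ring)
  convert h using 1
  module

end excess

/-! ### Almost supermartingales -/

/-- A nonnegative process that is a supermartingale up to the factors `1 + θ n`, with `∑ θ n`
convergent, is almost surely bounded. -/
theorem ae_bddAbove_of_setLIntegral_succ_le {Ω : Type*} {m0 : MeasurableSpace Ω} {P : Measure Ω}
    [IsFiniteMeasure P] (ℱ : Filtration ℕ m0) {X : ℕ → Ω → ℝ} {θ : ℕ → ℝ}
    (hX : ∀ n, Measurable[ℱ n] (X n)) (hnn : ∀ n ω, 0 ≤ X n ω)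
    (h0 : ∫⁻ ω, ENNReal.ofReal (X 0 ω) ∂P ≠ ⊤) (hθ : ∀ n, 0 ≤ θ n) (hsum : Summable θ)
    (hstep : ∀ n s, MeasurableSet[ℱ n] s → ∫⁻ ω in s, ENNReal.ofReal (X (n + 1) ω) ∂P
      ≤ ENNReal.ofReal (1 + θ n) * ∫⁻ ω in s, ENNReal.ofReal (X n ω) ∂P) :
    ∀ᵐ ω ∂P, BddAbove (Set.range fun n => X n ω) := by
  have hXm : ∀ n, Measurable (X n) := fun n => (hX n).mono (ℱ.le n) le_rfl
  have hfin : ∀ n, ∫⁻ ω, ENNReal.ofReal (X n ω) ∂P ≠ ⊤ := by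
    intro n
    induction n with
    | zero => exact h0
    | succ n ih =>
      have h := hstep n Set.univ MeasurableSet.univ
      simp only [Measure.restrict_univ] at h
      exact ne_top_of_le_ne_top (ENNReal.mul_ne_top ENNReal.ofReal_ne_top ih) h
  have hint : ∀ n, Integrable (X n) P := fun n =>
    ⟨(hXm n).aestronglyMeasurable, by
      rw [hasFiniteIntegral_iff_ofReal (Eventually.of_forall (hnn n))]
      exact (hfin n).lt_top⟩
  have hstepR : ∀ n s, MeasurableSet[ℱ n] s →
      ∫ ω in s, X (n + 1) ω ∂P ≤ (1 + θ n) * ∫ ω in s, X n ω ∂P := by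
    intro n s hs
    have h1 : 0 ≤ 1 + θ n := by linarith [hθ n]
    have hfs : ∫⁻ ω in s, ENNReal.ofReal (X n ω) ∂P ≠ ⊤ :=
      ne_top_of_le_ne_top (hfin n) (setLIntegral_le_lintegral _ _)
    rw [integral_eq_lintegral_of_nonneg_ae (Eventually.of_forall (hnn _))
        (hXm _).aestronglyMeasurable,
      integral_eq_lintegral_of_nonneg_ae (Eventually.of_forall (hnn _))
        (hXm _).aestronglyMeasurable]
    have h2 := ENNReal.toReal_mono (ENNReal.mul_ne_top ENNReal.ofReal_ne_top hfs) (hstep n s hs)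
    rwa [ENNReal.toReal_mul, ENNReal.toReal_ofReal h1] at h2
  -- Division by these products, which stay below `exp (∑ θ)`, leaves a genuine supermartingale.
  set p : ℕ → ℝ := fun n => ∏ k ∈ Finset.range n, (1 + θ k) with hp
  have hp_pos : ∀ n, 0 < p n := fun n => Finset.prod_pos fun k _ => by linarith [hθ k]
  have hp_le : ∀ n, p n ≤ Real.exp (∑' k, θ k) := by
    intro n
    calc p n ≤ ∏ k ∈ Finset.range n, Real.exp (θ k) :=
          Finset.prod_le_prod (fun k _ => by linarith [hθ k])
            (fun k _ => by linarith [Real.add_one_le_exp (θ k)])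
      _ = Real.exp (∑ k ∈ Finset.range n, θ k) := (Real.exp_sum _ _).symm
      _ ≤ _ := Real.exp_le_exp.2 (hsum.sum_le_tsum _ fun k _ => hθ k)
  have hsup : Supermartingale (fun n ω => (p n)⁻¹ * X n ω) ℱ P := by
    refine supermartingale_of_setIntegral_succ_le
      (fun n => ((hX n).const_mul _).stronglyMeasurable) (fun n => (hint n).const_mul _) ?_
    intro n s hs
    rw [integral_const_mul, integral_const_mul]
    have hpn : p (n + 1) = p n * (1 + θ n) := Finset.prod_range_succ _ _
    have h1 : 0 < 1 + θ n := by linarith [hθ n]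
    calc (p (n + 1))⁻¹ * ∫ ω in s, X (n + 1) ω ∂P
        ≤ (p (n + 1))⁻¹ * ((1 + θ n) * ∫ ω in s, X n ω ∂P) :=
          mul_le_mul_of_nonneg_left (hstepR n s hs) (inv_nonneg.2 (hp_pos _).le)
      _ = _ := by
          rw [hpn]; field_simp [(hp_pos n).ne', h1.ne']
  have hY0 : ∀ n, ∫ ω, (p n)⁻¹ * X n ω ∂P ≤ ∫ ω, X 0 ω ∂P := by
    intro n
    have h := hsup.setIntegral_le (Nat.zero_le n) MeasurableSet.univ
    simpa [hp] using h
  -- Doob's convergence theorem for the negated process: nonnegativity and decreasing means bound it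
  -- in L¹. A convergent path is bounded.
  have hconv := hsup.neg.exists_ae_tendsto_of_bdd (R := (∫ ω, X 0 ω ∂P).toNNReal) (by
    intro n
    simp only [Pi.neg_apply]
    rw [eLpNorm_neg, eLpNorm_one_eq_lintegral_enorm]
    have : ∀ ω, ‖(p n)⁻¹ * X n ω‖ₑ = ENNReal.ofReal ((p n)⁻¹ * X n ω) := fun ω =>
      Real.enorm_of_nonneg (mul_nonneg (inv_nonneg.2 (hp_pos n).le) (hnn n ω))
    simp_rw [this]
    rw [← ofReal_integral_eq_lintegral_ofReal ((hint n).const_mul _)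
      (Eventually.of_forall fun ω => mul_nonneg (inv_nonneg.2 (hp_pos n).le) (hnn n ω))]
    exact ENNReal.ofReal_le_ofReal (hY0 n))
  filter_upwards [hconv] with ω hω
  obtain ⟨c, hc⟩ := hω
  obtain ⟨b, hb⟩ := (hc.neg).bddAbove_range
  refine ⟨Real.exp (∑' k, θ k) * b, ?_⟩
  rintro _ ⟨n, rfl⟩
  have h1 : (p n)⁻¹ * X n ω ≤ b := by
    have := hb ⟨n, rfl⟩
    simpa using this
  have h2 : X n ω ≤ p n * b := by
    rwa [inv_mul_le_iff₀ (hp_pos n)] at h1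
  have hb0 : 0 ≤ b := le_trans (mul_nonneg (inv_nonneg.2 (hp_pos n).le) (hnn n ω)) h1
  exact h2.trans (mul_le_mul_of_nonneg_right (hp_le n) hb0)

/-! ### Pointwise bounds for the one-point gradient estimate -/

section inner
variable {E : Type*} [NormedAddCommGroup E] [InnerProductSpace ℝ E]

theorem abs_mul_inner_le {f : E → ℝ} {K : ℝ} (hK : 0 ≤ K) (hgrow : ∀ a, |f a| ≤ K * (1 + ‖a‖))
    {e : E} (he : ‖e‖ = 1) (m z : E) {s : ℝ} (hs : 0 ≤ s) :
    |f (m + s • z) * inner ℝ e z| ≤ K * ((1 + ‖m‖) * ‖z‖ + s * ‖z‖ ^ 2) := by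
  have h1 : ‖m + s • z‖ ≤ ‖m‖ + s * ‖z‖ := by
    refine (norm_add_le _ _).trans ?_
    rw [norm_smul, Real.norm_of_nonneg hs]
  have h2 : |inner ℝ e z| ≤ ‖z‖ := by
    simpa [he] using abs_real_inner_le_norm e z
  rw [abs_mul]
  calc |f (m + s • z)| * |inner ℝ e z|
      ≤ (K * (1 + (‖m‖ + s * ‖z‖))) * ‖z‖ := by
        gcongr
        exact (hgrow _).trans (by gcongr)
    _ = _ := by ring

theorem norm_sub_two_mul_inner_smul {e : E} (he : ‖e‖ = 1) (z : E) :
    ‖z - (2 * inner ℝ e z) • e‖ = ‖z‖ := by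
  have h1 : ‖z - (2 * inner ℝ e z) • e‖ ^ 2 = ‖z‖ ^ 2 := by
    rw [norm_sub_sq_real, norm_smul, he, inner_smul_right, real_inner_comm,
      mul_one, Real.norm_eq_abs, sq_abs]
    ring
  exact (pow_left_inj₀ (norm_nonneg _) (norm_nonneg _) two_ne_zero).1 h1

/-- The increment of `f` between a point and its mirror image in the hyperplane orthogonal to `e`
is close to its linearization at `m`. -/
theorem abs_sub_reflection_le {f : E → ℝ} (hf : Differentiable ℝ f) {e : E} (he : ‖e‖ = 1) {L : ℝ}
    (hL0 : 0 ≤ L) (hL : ∀ a b, |fderiv ℝ f a e - fderiv ℝ f b e| ≤ L * ‖a - b‖) (m z : E) {s : ℝ}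
    (hs : 0 ≤ s) :
    |f (m + s • z) - f (m + s • (z - (2 * inner ℝ e z) • e)) - 2 * s * inner ℝ e z * fderiv ℝ f m e|
      ≤ 2 * s ^ 2 * L * |inner ℝ e z| * ‖z‖ := by
  set h := inner ℝ e z with hh
  set ρ := z - (2 * h) • e with hρ
  have hρn : ‖ρ‖ = ‖z‖ := norm_sub_two_mul_inner_smul he z
  -- The segment from `m + s • z` to its mirror image runs in direction `e`, so only the derivative
  -- along `e` enters and only that one has to be Lipschitz.
  let q : ℝ → E := fun u => m + s • (z - (2 * h * u) • e)
  have hq : ∀ u, HasDerivAt q (-(2 * s * h) • e) u := by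
    intro u
    have h1 : HasDerivAt (fun u : ℝ => 2 * h * u) (2 * h) u := by
      simpa using (hasDerivAt_id u).const_mul (2 * h)
    have h2 := (((h1.smul_const e).const_sub z).const_smul s).const_add m
    convert! h2 using 1
    module
  -- The added linear term removes the linearization at `m`; the derivative left over is the
  -- variation of `∂ₑ f` between `m` and the segment.
  have hg : ∀ u ∈ Set.Icc (0 : ℝ) 1, HasDerivWithinAt
      (fun u => f (q u) + 2 * s * h * fderiv ℝ f m e * u)
      (fderiv ℝ f (q u) (-(2 * s * h) • e) + 2 * s * h * fderiv ℝ f m e) (Set.Icc 0 1) u := by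
    intro u _
    have h1 := (hf (q u)).hasFDerivAt.comp_hasDerivAt u (hq u)
    have h2 : HasDerivAt (fun u : ℝ => 2 * s * h * fderiv ℝ f m e * u)
        (2 * s * h * fderiv ℝ f m e) u := by
      simpa using (hasDerivAt_id u).const_mul (2 * s * h * fderiv ℝ f m e)
    exact (h1.add h2).hasDerivWithinAt
  have hb : ∀ u ∈ Set.Ico (0 : ℝ) 1,
      ‖fderiv ℝ f (q u) (-(2 * s * h) • e) + 2 * s * h * fderiv ℝ f m e‖
        ≤ 2 * s ^ 2 * L * |h| * ‖z‖ := by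
    intro u hu
    have h1 : fderiv ℝ f (q u) (-(2 * s * h) • e) + 2 * s * h * fderiv ℝ f m e
        = -(2 * s * h) * (fderiv ℝ f (q u) e - fderiv ℝ f m e) := by
      rw [map_smul, smul_eq_mul]; ring
    -- Points of the segment are `m` plus `s` times a convex combination of `z` and its mirror
    -- image, which have equal norms.
    have h2 : ‖q u - m‖ ≤ s * ‖z‖ := by
      have h3 : q u - m = s • ((1 - u) • z + u • ρ) := by
        simp only [q, hρ]; module
      rw [h3, norm_smul, Real.norm_of_nonneg hs]
      refine mul_le_mul_of_nonneg_left ((norm_add_le _ _).trans ?_) hs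
      rw [norm_smul, norm_smul, hρn, Real.norm_of_nonneg hu.1,
        Real.norm_of_nonneg (by linarith [hu.2])]
      linarith
    rw [h1, Real.norm_eq_abs, abs_mul, abs_neg, abs_mul, abs_mul, abs_of_nonneg hs,
      abs_of_pos (two_pos : (0 : ℝ) < 2)]
    calc 2 * s * |h| * |fderiv ℝ f (q u) e - fderiv ℝ f m e|
        ≤ 2 * s * |h| * (L * (s * ‖z‖)) := by
          gcongr
          exact (hL _ _).trans (by gcongr)
      _ = _ := by ring
  have hmain := norm_image_sub_le_of_norm_deriv_le_segment_01' hg hb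
  rw [Real.norm_eq_abs, abs_sub_comm] at hmain
  convert hmain using 2
  simp only [q, hρ]
  simp
  ring

end inner

/-! ### Bias and second moment under the Gaussian law -/

section smoothing
variable {E : Type*} [NormedAddCommGroup E] [InnerProductSpace ℝ E] [FiniteDimensional ℝ E]
  [MeasurableSpace E] [BorelSpace E]

theorem integrable_norm_pow_stdGaussian (k : ℕ) :
    Integrable (fun z : E => ‖z‖ ^ k) (stdGaussian E) :=
  (IsGaussian.memLp_id (stdGaussian E) k (by simp)).integrable_norm_pow'

theorem integral_inner_sq_stdGaussian {e : E} (he : ‖e‖ = 1) :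
    ∫ z, (inner ℝ e z) ^ 2 ∂(stdGaussian E) = 1 := by
  have h := variance_dual_stdGaussian (E := E) (innerSL ℝ e)
  rw [variance_of_integral_eq_zero (by fun_prop) (integral_strongDual_stdGaussian _)] at h
  simpa [he] using h

theorem memLp_two_mul_inner {f : E → ℝ} (hf : Continuous f) {K : ℝ} (hK : 0 ≤ K)
    (hgrow : ∀ a, |f a| ≤ K * (1 + ‖a‖)) {e : E} (he : ‖e‖ = 1) (m : E) {s : ℝ} (hs : 0 ≤ s) :
    MemLp (fun z => f (m + s • z) * inner ℝ e z) 2 (stdGaussian E) := by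
  have h1 : MemLp (fun z : E => ‖z‖) 2 (stdGaussian E) :=
    (IsGaussian.memLp_id (stdGaussian E) 2 (by simp)).norm
  have h2 : MemLp (fun z : E => ‖z‖ ^ 2) 2 (stdGaussian E) := by
    rw [memLp_two_iff_integrable_sq (by fun_prop)]
    simpa [← pow_mul] using integrable_norm_pow_stdGaussian (E := E) 4
  have h3 := ((h1.const_mul (1 + ‖m‖)).add (h2.const_mul s)).const_mul K
  refine h3.mono' (by fun_prop) (Eventually.of_forall fun z => ?_)
  simpa using abs_mul_inner_le hK hgrow he m z hs

/-- The factor `4 + 2 * S ^ 2` comes from using `(u + v) ^ 2 ≤ 2 * u ^ 2 + 2 * v ^ 2` twice; the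
constant depends on neither `m` nor `s`. -/
theorem integral_mul_inner_sq_le {f : E → ℝ} (hf : Continuous f) {K : ℝ} (hK : 0 ≤ K)
    (hgrow : ∀ a, |f a| ≤ K * (1 + ‖a‖)) {e : E} (he : ‖e‖ = 1) (m : E) {s S : ℝ} (hs : 0 ≤ s)
    (hsS : s ≤ S) :
    ∫ z, (f (m + s • z) * inner ℝ e z) ^ 2 ∂(stdGaussian E)
      ≤ (K ^ 2 * (4 + 2 * S ^ 2) * ∫ z, (‖z‖ ^ 2 + ‖z‖ ^ 4) ∂(stdGaussian E)) * (1 + ‖m‖ ^ 2) := by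
  rw [mul_right_comm, ← integral_const_mul]
  refine integral_mono (memLp_two_mul_inner hf hK hgrow he m hs).integrable_sq
    (((integrable_norm_pow_stdGaussian 2).add (integrable_norm_pow_stdGaussian 4)).const_mul _)
    fun z => ?_
  have h := abs_mul_inner_le hK hgrow he m z hs
  have h2 : (f (m + s • z) * inner ℝ e z) ^ 2 ≤ (K * ((1 + ‖m‖) * ‖z‖ + s * ‖z‖ ^ 2)) ^ 2 := by
    rw [← sq_abs]; gcongr
  refine h2.trans ?_
  have h3 : (s * ‖z‖ ^ 2) ^ 2 ≤ S ^ 2 * ‖z‖ ^ 4 := by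
    rw [mul_pow, ← pow_mul]; gcongr
  have h4 : ((1 + ‖m‖) * ‖z‖ + s * ‖z‖ ^ 2) ^ 2
      ≤ 2 * ((1 + ‖m‖) * ‖z‖) ^ 2 + 2 * (s * ‖z‖ ^ 2) ^ 2 := by
    nlinarith [sq_nonneg ((1 + ‖m‖) * ‖z‖ - s * ‖z‖ ^ 2)]
  have h5 : (1 + ‖m‖) ^ 2 ≤ 2 * (1 + ‖m‖ ^ 2) := by nlinarith [sq_nonneg (1 - ‖m‖)]
  have h6 : ((1 + ‖m‖) * ‖z‖) ^ 2 ≤ 2 * (1 + ‖m‖ ^ 2) * ‖z‖ ^ 2 := by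
    rw [mul_pow]; gcongr
  have h7 : ((1 + ‖m‖) * ‖z‖ + s * ‖z‖ ^ 2) ^ 2
      ≤ (4 + 2 * S ^ 2) * (1 + ‖m‖ ^ 2) * (‖z‖ ^ 2 + ‖z‖ ^ 4) := by
    have e1 : 0 ≤ S ^ 2 * ‖z‖ ^ 4 * ‖m‖ ^ 2 := by positivity
    have e2 : 0 ≤ S ^ 2 * ‖z‖ ^ 2 * (1 + ‖m‖ ^ 2) := by positivity
    have e3 : 0 ≤ ‖z‖ ^ 4 * (1 + ‖m‖ ^ 2) := by positivity
    nlinarith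
  rw [mul_pow]
  calc _ ≤ K ^ 2 * ((4 + 2 * S ^ 2) * (1 + ‖m‖ ^ 2) * (‖z‖ ^ 2 + ‖z‖ ^ 4)) := by gcongr
    _ = _ := by ring

/-- Linear isometries preserve the standard Gaussian. Symmetrizing under this reflection takes the
place of integration by parts. -/
theorem integral_comp_reflection_stdGaussian {e : E} (he : ‖e‖ = 1) (F : E → ℝ) :
    ∫ z, F (z - (2 * inner ℝ e z) • e) ∂(stdGaussian E) = ∫ z, F z ∂(stdGaussian E) := by
  let ρ : E ≃ₗᵢ[ℝ] E := (ℝ ∙ e)ᗮ.reflection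
  have hρ : ∀ z, ρ z = z - (2 * inner ℝ e z) • e := by
    intro z
    simp only [ρ, Submodule.reflection_orthogonal_apply, Submodule.reflection_singleton_apply, he]
    simp
    module
  conv_rhs => rw [← stdGaussian_map ρ]
  have h := ρ.toHomeomorph.toMeasurableEquiv.measurableEmbedding.integral_map
    (μ := stdGaussian E) F
  refine Eq.trans (integral_congr_ae (Eventually.of_forall fun z => ?_)) h.symm
  exact congrArg F (hρ z).symm

/-- The one-point gradient estimate `f (m + s z) s ⟨e, z⟩`, with `z` standard Gaussian, has the
expectation `s² ∂ₑ f (m)` up to an error of order `s³`. -/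
theorem abs_integral_mul_inner_sub_le {f : E → ℝ} (hf : Differentiable ℝ f) {K : ℝ} (hK : 0 ≤ K)
    (hgrow : ∀ a, |f a| ≤ K * (1 + ‖a‖)) {e : E} (he : ‖e‖ = 1) {L : ℝ} (hL0 : 0 ≤ L)
    (hL : ∀ a b, |fderiv ℝ f a e - fderiv ℝ f b e| ≤ L * ‖a - b‖) (m : E) {s : ℝ} (hs : 0 ≤ s) :
    |(∫ z, f (m + s • z) * inner ℝ e z ∂(stdGaussian E)) - s * fderiv ℝ f m e|
      ≤ (L * ∫ z, ‖z‖ ^ 3 ∂(stdGaussian E)) * s ^ 2 := by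
  set F : E → ℝ := fun z => f (m + s • z) * inner ℝ e z with hF
  set c := fderiv ℝ f m e
  have hFi : Integrable F (stdGaussian E) :=
    (memLp_two_mul_inner hf.continuous hK hgrow he m hs).integrable (by norm_num)
  have hhi : Integrable (fun z : E => (inner ℝ e z) ^ 2) (stdGaussian E) := by
    refine (integrable_norm_pow_stdGaussian 2).mono' (by fun_prop)
      (Eventually.of_forall fun z => ?_)
    rw [norm_pow]
    gcongr
    simpa [he] using abs_real_inner_le_norm e z
  have hFr : ∀ z, F (z - (2 * inner ℝ e z) • e)
      = -(f (m + s • (z - (2 * inner ℝ e z) • e)) * inner ℝ e z) := by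
    intro z
    have : inner ℝ e (z - (2 * inner ℝ e z) • e) = -inner ℝ e z := by
      rw [inner_sub_right, inner_smul_right, real_inner_self_eq_norm_sq, he]; ring
    simp only [hF, this]; ring
  have hFri : Integrable (fun z => F (z - (2 * inner ℝ e z) • e)) (stdGaussian E) := by
    have h1 := abs_mul_inner_le hK hgrow he m
    have hdom : Integrable (fun z : E => K * ((1 + ‖m‖) * ‖z‖ ^ 1 + s * ‖z‖ ^ 2))
        (stdGaussian E) :=
      (((integrable_norm_pow_stdGaussian 1).const_mul _).add
        ((integrable_norm_pow_stdGaussian 2).const_mul _)).const_mul _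
    have hc := hf.continuous
    refine hdom.mono' (by simp only [hF]; fun_prop) (Eventually.of_forall fun z => ?_)
    have := h1 (z - (2 * inner ℝ e z) • e) hs
    rw [norm_sub_two_mul_inner_smul he] at this
    simpa [hF] using this
  -- The factor `⟪e, z⟫` is odd under the reflection, so averaging produces increments of `f`; `𝔼
  -- ⟪e, z⟫ ^ 2 = 1` identifies their linear part.
  have hsplit : 2 * ((∫ z, F z ∂(stdGaussian E)) - s * c)
      = ∫ z, (F z + F (z - (2 * inner ℝ e z) • e) - 2 * s * c * (inner ℝ e z) ^ 2)
          ∂(stdGaussian E) := by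
    rw [integral_sub (f := fun z => F z + F (z - (2 * inner ℝ e z) • e)) (hFi.add hFri)
        (hhi.const_mul _), integral_add hFi hFri,
      integral_comp_reflection_stdGaussian he, integral_const_mul,
      integral_inner_sq_stdGaussian he]
    ring
  have hbound : |2 * ((∫ z, F z ∂(stdGaussian E)) - s * c)|
      ≤ ∫ z, 2 * s ^ 2 * L * ‖z‖ ^ 3 ∂(stdGaussian E) := by
    rw [hsplit, ← Real.norm_eq_abs]
    refine norm_integral_le_of_norm_le ((integrable_norm_pow_stdGaussian 3).const_mul _)
      (Eventually.of_forall fun z => ?_)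
    have h2 : |inner ℝ e z| ≤ ‖z‖ := by
      simpa [he] using abs_real_inner_le_norm e z
    have h3 := abs_sub_reflection_le hf he hL0 hL m z hs
    rw [hFr, Real.norm_eq_abs]
    calc |F z + -(f (m + s • (z - (2 * inner ℝ e z) • e)) * inner ℝ e z)
          - 2 * s * c * (inner ℝ e z) ^ 2|
        = |f (m + s • z) - f (m + s • (z - (2 * inner ℝ e z) • e)) - 2 * s * inner ℝ e z * c|
            * |inner ℝ e z| := by
          rw [← abs_mul]; congr 1; simp only [hF]; ring
      _ ≤ (2 * s ^ 2 * L * |inner ℝ e z| * ‖z‖) * |inner ℝ e z| := by gcongr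
      _ ≤ (2 * s ^ 2 * L * ‖z‖ * ‖z‖) * ‖z‖ := by gcongr
      _ = _ := by ring
  rw [integral_const_mul, abs_mul, abs_of_pos (two_pos : (0 : ℝ) < 2)] at hbound
  linarith

end smoothing

/-! ### The law of the state given the past -/

theorem isotropicGaussian_eq_map_stdGaussian {N d : ℕ} (m : JointSpace N d) (s : ℝ) :
    isotropicGaussian m s = (stdGaussian (JointSpace N d)).map (fun z => m + s • z) := by
  have h1 : ∀ p, gaussianReal (m p) (s ^ 2).toNNReal
      = (gaussianReal 0 1).map (fun y => m p + s * y) := by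
    intro p
    rw [show (fun y : ℝ => m p + s * y) = (fun y => m p + y) ∘ (fun y => s * y) from rfl,
      ← Measure.map_map (by fun_prop) (by fun_prop), gaussianReal_map_const_mul,
      gaussianReal_map_const_add]
    congr 1
    · simp
    · ext; simp [sq_nonneg]
  rw [isotropicGaussian, ← map_pi_eq_stdGaussian,
    Measure.map_map (by fun_prop) (by fun_prop)]
  simp_rw [h1]
  have : ∀ p, SigmaFinite ((gaussianReal 0 1).map (fun y => m p + s * y)) := fun p => by
    rw [← h1]; infer_instance
  rw [← Measure.pi_map_pi (fun p => by fun_prop), Measure.map_map (by fun_prop) (by fun_prop)]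
  rfl

theorem history_le {N d : ℕ} {Ω : Type*} [m0 : MeasurableSpace Ω] {x μ : ℕ → Ω → JointSpace N d}
    (hx : ∀ t, Measurable (x t)) (hμ : ∀ t, Measurable (μ t)) (t : ℕ) : history x μ t ≤ m0 :=
  sup_le (iSup₂_le fun k _ => (hx k).comap_le) (iSup₂_le fun k _ => (hμ k).comap_le)

theorem history_mono {N d : ℕ} {Ω : Type*} (x μ : ℕ → Ω → JointSpace N d) :
    Monotone (history x μ) := fun _ _ h =>
  sup_le_sup (iSup₂_mono' fun k hk => ⟨k, hk.trans_le h, le_rfl⟩)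
    (iSup₂_mono' fun k hk => ⟨k, hk.trans h, le_rfl⟩)

theorem measurable_mean_history {N d : ℕ} {Ω : Type*} (x μ : ℕ → Ω → JointSpace N d) (t : ℕ) :
    Measurable[history x μ t] (μ t) :=
  Measurable.of_comap_le (le_sup_of_le_right (le_iSup₂_of_le t le_rfl le_rfl))

/-- Integrating over the past of a run: given the past, `x(t)` is `μ(t) + σ(t) z` with a standard
Gaussian `z`. -/
theorem IsPayoffBasedRun.setLIntegral_eq {N d : ℕ} {G : ContinuousGame N d} {γ σ ε : ℕ → ℝ}
    {μ₀ : JointSpace N d} {Ω : Type*} [MeasurableSpace Ω] {P : Measure Ω} [IsProbabilityMeasure P]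
    {x μ : ℕ → Ω → JointSpace N d} (hrun : IsPayoffBasedRun G γ σ ε μ₀ P x μ) (t : ℕ) {s : Set Ω}
    (hs : MeasurableSet[history x μ t] s) {F : JointSpace N d × JointSpace N d → ENNReal}
    (hF : Measurable F) :
    ∫⁻ ω in s, F (μ t ω, x t ω) ∂P
      = ∫⁻ ω in s, ∫⁻ z, F (μ t ω, μ t ω + σ t • z) ∂(stdGaussian (JointSpace N d)) ∂P := by
  have hx := hrun.measurable_state t
  have hμ := hrun.measurable_mean t
  have hle := history_le hrun.measurable_state hrun.measurable_mean t
  have hlaw : (P.restrict s).map (fun ω => (μ t ω, x t ω))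
      = (((P.restrict s).map (μ t)).prod (stdGaussian (JointSpace N d))).map
          (fun q => (q.1, q.1 + σ t • q.2)) := by
    -- Rectangles suffice: `{μ t ∈ U} ∩ s` belongs to the past, so the conditional law of `x t` may
    -- be integrated over it.
    refine Measure.ext_prod fun {U V} hU hV => ?_
    have hUm : MeasurableSet[history x μ t] (μ t ⁻¹' U ∩ s) :=
      (measurable_mean_history x μ t hU).inter hs
    rw [Measure.map_apply (by fun_prop) (hU.prod hV),
      Measure.map_apply (by fun_prop) (hU.prod hV),
      Measure.prod_apply ((by fun_prop : Measurable fun q : JointSpace N d × JointSpace N d =>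
        (q.1, q.1 + σ t • q.2)) (hU.prod hV)),
      lintegral_map (measurable_measure_prodMk_left
        ((by fun_prop : Measurable fun q : JointSpace N d × JointSpace N d =>
        (q.1, q.1 + σ t • q.2)) (hU.prod hV))) hμ]
    have hR : ∀ ω, (stdGaussian (JointSpace N d)) (Prod.mk (μ t ω) ⁻¹'
        ((fun q : JointSpace N d × JointSpace N d => (q.1, q.1 + σ t • q.2)) ⁻¹' U ×ˢ V))
        = (μ t ⁻¹' U).indicator (fun ω => isotropicGaussian (μ t ω) (σ t) V) ω := by
      intro ω
      by_cases h : μ t ω ∈ U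
      · rw [Set.indicator_of_mem (by exact h), isotropicGaussian_eq_map_stdGaussian,
          Measure.map_apply (by fun_prop) hV]
        congr 1; ext z; simp [h]
      · rw [Set.indicator_of_notMem (by exact h)]
        convert measure_empty (μ := stdGaussian (JointSpace N d))
        ext z; simp [h]
    simp_rw [hR]
    rw [lintegral_indicator (hμ hU), Measure.restrict_restrict (hμ hU)]
    have hprob : ∀ ω, IsProbabilityMeasure (isotropicGaussian (μ t ω) (σ t)) := fun ω => by
      rw [isotropicGaussian_eq_map_stdGaussian]
      exact Measure.isProbabilityMeasure_map (by fun_prop)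
    have h1 : ∫ ω in μ t ⁻¹' U ∩ s, (P⟦x t ⁻¹' V | history x μ t⟧) ω ∂P
        = P.real (x t ⁻¹' V ∩ (μ t ⁻¹' U ∩ s)) := by
      rw [setIntegral_condExp hle ((integrable_const (1 : ℝ)).indicator (hx hV)) hUm,
        integral_indicator (hx hV), Measure.restrict_restrict (hx hV)]
      simp
    have h2 : ∫ ω in μ t ⁻¹' U ∩ s, (P⟦x t ⁻¹' V | history x μ t⟧) ω ∂P
        = ∫ ω in μ t ⁻¹' U ∩ s, (isotropicGaussian (μ t ω) (σ t)).real V ∂P :=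
      integral_congr_ae (ae_restrict_of_ae (hrun.state_law t V hV))
    have h3 : Integrable (fun ω => (isotropicGaussian (μ t ω) (σ t)).real V) P :=
      integrable_condExp.congr (hrun.state_law t V hV)
    have h4 := ofReal_integral_eq_lintegral_ofReal (h3.integrableOn (s := μ t ⁻¹' U ∩ s))
      (Eventually.of_forall fun ω => measureReal_nonneg)
    rw [← h2, h1, ofReal_measureReal] at h4
    have h5 : ∀ ω, ENNReal.ofReal ((isotropicGaussian (μ t ω) (σ t)).real V)
        = isotropicGaussian (μ t ω) (σ t) V := fun ω => ofReal_measureReal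
    simp only [h5] at h4
    rw [← h4, Measure.restrict_apply (((hμ.prodMk hx)) (hU.prod hV))]
    congr 1; ext ω; simp; tauto
  rw [← lintegral_map hF (hμ.prodMk hx), hlaw, lintegral_map hF (by fun_prop),
    lintegral_prod _ (by fun_prop), lintegral_map _ hμ]
  exact Measurable.lintegral_prod_right' (f := fun q : JointSpace N d × JointSpace N d =>
    F (q.1, q.1 + σ t • q.2)) (by fun_prop)

/-! ### One step of the algorithm -/

/-- Compactness covers the ball of radius `Q`, where the growth condition is silent. -/
theorem GrowsAtMostLinearly.exists_abs_le {n : Type*} [Fintype n] {f : EuclideanSpace ℝ n → ℝ}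
    (h : GrowsAtMostLinearly f) (hf : Continuous f) :
    ∃ K, 0 ≤ K ∧ ∀ a, |f a| ≤ K * (1 + ‖a‖) := by
  obtain ⟨K, Q, hK⟩ := h
  obtain ⟨B, hB⟩ := (isCompact_closedBall (0 : EuclideanSpace ℝ n) Q).exists_bound_of_continuousOn
    hf.continuousOn
  refine ⟨|K| + |B|, by positivity, fun a => ?_⟩
  have h0 := norm_nonneg a
  rcases le_total Q ‖a‖ with ha | ha
  · refine (hK a ha).trans ?_
    gcongr
    exact (le_abs_self K).trans (by linarith [abs_nonneg B])
  · have h1 : |f a| ≤ B := hB a (by simpa using ha)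
    nlinarith [le_abs_self B, abs_nonneg B, abs_nonneg K, mul_nonneg (abs_nonneg K) h0,
      mul_nonneg (abs_nonneg B) h0]

/-- The displacement of the joint mean `m` before the projection, if the state is `y`. -/
noncomputable def payoffStep {N d : ℕ} (G : ContinuousGame N d) (g κ : ℝ) (m y : JointSpace N d) :
    JointSpace N d :=
  WithLp.toLp 2 fun p => g * (G.J p.1 y * (y p - m p)) + κ * m p

/-- Squared norms add up over the players, so the projections can be treated one block at a time. -/
theorem IsPayoffBasedRun.norm_mean_succ_sub_le {N d : ℕ} {G : ContinuousGame N d}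
    (hA_convex : ∀ i, Convex ℝ (G.A i)) {γ σ ε : ℕ → ℝ} {μ₀ : JointSpace N d} {Ω : Type*}
    [MeasurableSpace Ω] {P : Measure Ω} {x μ : ℕ → Ω → JointSpace N d}
    (hrun : IsPayoffBasedRun G γ σ ε μ₀ P x μ) {t : ℕ} (ht : σ t ≠ 0) (ω : Ω) {w : JointSpace N d}
    (hw : w ∈ G.jointActions) :
    ‖μ (t + 1) ω - w‖
      ≤ ‖μ t ω - w - payoffStep G (γ t) (γ t * σ t ^ 2 * ε t) (μ t ω) (x t ω)‖ := by
  refine le_of_sq_le_sq ?_ (norm_nonneg _)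
  rw [norm_sq_eq_sum_norm_block_sq, norm_sq_eq_sum_norm_block_sq]
  refine Finset.sum_le_sum fun i _ => pow_le_pow_left₀ (norm_nonneg _) ?_ 2
  have h := (hrun.update t ω i).norm_sub_le (hA_convex i) (hw i)
  rw [block_sub]
  refine h.trans_eq (congrArg _ ?_)
  ext k
  simp only [block, payoffStep, PiLp.sub_apply, PiLp.smul_apply, PiLp.add_apply, smul_eq_mul]
  -- The factor `σ ^ 2` of the step size cancels the division by `σ ^ 2` in the estimate.
  field_simp
  ring

theorem mem_jointActions_mean_succ {N d : ℕ} {G : ContinuousGame N d} {γ σ ε : ℕ → ℝ}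
    {μ₀ : JointSpace N d} {Ω : Type*} [MeasurableSpace Ω] {P : Measure Ω}
    {x μ : ℕ → Ω → JointSpace N d} (hrun : IsPayoffBasedRun G γ σ ε μ₀ P x μ) (t : ℕ) (ω : Ω) :
    μ (t + 1) ω ∈ G.jointActions := fun i => (hrun.update t ω i).1

theorem convex_jointActions {N d : ℕ} {G : ContinuousGame N d}
    (hA_convex : ∀ i, Convex ℝ (G.A i)) : Convex ℝ G.jointActions :=
  fun _ hu _ hv _ _ hs ht hst i => hA_convex i (hu i) (hv i) hs ht hst

/-- Bias and second moment of the gradient estimates. -/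
theorem exists_gradient_estimate_bounds {N d : ℕ} {G : ContinuousGame N d}
    (hJ : ∀ i, Differentiable ℝ (G.J i))
    (hlip : ∀ i, ∃ L : NNReal, LipschitzWith L (fun a => block (G.gameMapping a) i))
    (hgrowth : ∀ i, GrowsAtMostLinearly (G.J i)) (S : ℝ) :
    ∃ C, 0 ≤ C ∧ ∀ (p : Fin N × Fin d) (m : JointSpace N d) (s : ℝ), 0 ≤ s → s ≤ S →
      MemLp (fun z => G.J p.1 (m + s • z) * (s * z p)) 2 (stdGaussian (JointSpace N d)) ∧
      |(∫ z, G.J p.1 (m + s • z) * (s * z p) ∂(stdGaussian (JointSpace N d)))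
        - s ^ 2 * G.gameMapping m p| ≤ C * s ^ 3 ∧
      ∫ z, (G.J p.1 (m + s • z) * (s * z p)) ^ 2 ∂(stdGaussian (JointSpace N d))
        ≤ C * (1 + ‖m‖ ^ 2) := by
  choose K hK0 hK using fun i => (hgrowth i).exists_abs_le (hJ i).continuous
  choose L hL using hlip
  set I3 := ∫ z, ‖z‖ ^ 3 ∂(stdGaussian (JointSpace N d))
  set I4 := ∫ z, (‖z‖ ^ 2 + ‖z‖ ^ 4) ∂(stdGaussian (JointSpace N d))
  have hI3 : 0 ≤ I3 := integral_nonneg fun z => by positivity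
  have hI4 : 0 ≤ I4 := integral_nonneg fun z => by positivity
  -- The first summand controls the bias, the second the second moment; summing over the players
  -- gives one constant for all.
  let c : Fin N → ℝ := fun i => L i * I3 + S ^ 2 * (K i ^ 2 * (4 + 2 * S ^ 2) * I4)
  have hc1 : ∀ i, 0 ≤ L i * I3 := fun i => mul_nonneg (L i).2 hI3
  have hc2 : ∀ i, 0 ≤ S ^ 2 * (K i ^ 2 * (4 + 2 * S ^ 2) * I4) := fun i =>
    mul_nonneg (sq_nonneg _) (mul_nonneg (by positivity) hI4)
  have hc : ∀ i, 0 ≤ c i := fun i => add_nonneg (hc1 i) (hc2 i)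
  refine ⟨∑ i, c i, Finset.sum_nonneg fun i _ => hc i, fun p m s hs hsS => ?_⟩
  have hcp : c p.1 ≤ ∑ i, c i := Finset.single_le_sum (fun i _ => hc i) (Finset.mem_univ _)
  have he : ‖(EuclideanSpace.single p (1 : ℝ) : JointSpace N d)‖ = 1 := by simp
  have hin : ∀ z : JointSpace N d, z p = inner ℝ (EuclideanSpace.single p (1 : ℝ)) z := fun z => by
    simp [EuclideanSpace.inner_single_left]
  have hF : ∀ z : JointSpace N d, G.J p.1 (m + s • z) * (s * z p)
      = s * (G.J p.1 (m + s • z) * inner ℝ (EuclideanSpace.single p (1 : ℝ)) z) := fun z => by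
    rw [← hin]; ring
  have hLp : ∀ a b, |fderiv ℝ (G.J p.1) a (EuclideanSpace.single p 1)
      - fderiv ℝ (G.J p.1) b (EuclideanSpace.single p 1)| ≤ L p.1 * ‖a - b‖ := by
    intro a b
    have h1 := (hL p.1).norm_sub_le a b
    refine le_trans ?_ h1
    exact PiLp.norm_apply_le (block (G.gameMapping a) p.1 - block (G.gameMapping b) p.1) p.2
  have hbias := abs_integral_mul_inner_sub_le (hJ p.1) (hK0 _) (hK _) he (L p.1).2 hLp m hs
  have hsq := integral_mul_inner_sq_le (hJ p.1).continuous (hK0 _) (hK _) he m hs hsS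
  have hsq0 : 0 ≤ ∫ z, (G.J p.1 (m + s • z) * inner ℝ (EuclideanSpace.single p (1 : ℝ)) z) ^ 2
      ∂(stdGaussian (JointSpace N d)) := integral_nonneg fun z => sq_nonneg _
  simp only [hF]
  refine ⟨(memLp_two_mul_inner (hJ p.1).continuous (hK0 _) (hK _) he m hs).const_mul s, ?_, ?_⟩
  · rw [integral_const_mul]
    have h1 : G.gameMapping m p = fderiv ℝ (G.J p.1) m (EuclideanSpace.single p 1) := rfl
    rw [h1, show ∀ u v : ℝ, s * u - s ^ 2 * v = s * (u - s * v) from fun u v => by ring,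
      abs_mul, abs_of_nonneg hs]
    refine (mul_le_mul_of_nonneg_left hbias hs).trans ?_
    calc s * (L p.1 * I3 * s ^ 2)
        = L p.1 * I3 * s ^ 3 := by ring
      _ ≤ (∑ i, c i) * s ^ 3 := mul_le_mul_of_nonneg_right
          ((le_add_of_nonneg_right (hc2 p.1)).trans hcp) (pow_nonneg hs 3)
  · simp only [mul_pow s]
    rw [integral_const_mul]
    refine (mul_le_mul (pow_le_pow_left₀ hs hsS 2) hsq hsq0 (sq_nonneg S)).trans ?_
    calc S ^ 2 * (K p.1 ^ 2 * (4 + 2 * S ^ 2) * I4 * (1 + ‖m‖ ^ 2))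
        = S ^ 2 * (K p.1 ^ 2 * (4 + 2 * S ^ 2) * I4) * (1 + ‖m‖ ^ 2) := by ring
      _ ≤ (∑ i, c i) * (1 + ‖m‖ ^ 2) := mul_le_mul_of_nonneg_right
          ((le_add_of_nonneg_left (hc1 p.1)).trans hcp) (by positivity)

/-- The mean squared distance after one step, expanded to second order. -/
theorem lintegral_norm_sub_payoffStep_sq_le {N d : ℕ} {G : ContinuousGame N d} (g κ s : ℝ)
    (q m : JointSpace N d)
    (hmem : ∀ p : Fin N × Fin d,
      MemLp (fun z => G.J p.1 (m + s • z) * (s * z p)) 2 (stdGaussian (JointSpace N d))) :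
    ∫⁻ z, ENNReal.ofReal (1 + ‖q - payoffStep G g κ m (m + s • z)‖ ^ 2)
        ∂(stdGaussian (JointSpace N d))
      ≤ ENNReal.ofReal (1 + (‖q‖ ^ 2 - 2 * κ * inner ℝ q m + 2 * κ ^ 2 * ‖m‖ ^ 2
        + ∑ p, (2 * g ^ 2
              * ∫ z, (G.J p.1 (m + s • z) * (s * z p)) ^ 2 ∂(stdGaussian (JointSpace N d))
            - 2 * g * (q p
              * ∫ z, G.J p.1 (m + s • z) * (s * z p) ∂(stdGaussian (JointSpace N d)))))) := by
  set ν := stdGaussian (JointSpace N d)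
  set F : Fin N × Fin d → JointSpace N d → ℝ := fun p z => G.J p.1 (m + s • z) * (s * z p) with hF
  set c := 1 + (‖q‖ ^ 2 - 2 * κ * inner ℝ q m + 2 * κ ^ 2 * ‖m‖ ^ 2) with hc
  have hint1 : ∀ p, Integrable (F p) ν := fun p => (hmem p).integrable (by norm_num)
  have hint2 : ∀ p, Integrable (fun z => F p z ^ 2) ν := fun p => (hmem p).integrable_sq
  have hintp : ∀ p, Integrable (fun z => 2 * g ^ 2 * F p z ^ 2 - 2 * g * (q p * F p z)) ν :=
    fun p => ((hint2 p).const_mul _).sub (((hint1 p).const_mul _).const_mul _)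
  have hints : Integrable (fun z => ∑ p, (2 * g ^ 2 * F p z ^ 2 - 2 * g * (q p * F p z))) ν :=
    integrable_finsetSum _ fun p _ => hintp p
  have hpt : ∀ z, 1 + ‖q - payoffStep G g κ m (m + s • z)‖ ^ 2
      ≤ c + ∑ p, (2 * g ^ 2 * F p z ^ 2 - 2 * g * (q p * F p z)) := by
    intro z
    have hi : (inner ℝ q m : ℝ) = ∑ p, q p * m p := by
      simp [PiLp.inner_apply, mul_comm]
    rw [hc, hi, EuclideanSpace.real_norm_sq_eq, EuclideanSpace.real_norm_sq_eq,
      EuclideanSpace.real_norm_sq_eq, Finset.mul_sum, Finset.mul_sum, ← Finset.sum_sub_distrib,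
      ← Finset.sum_add_distrib, add_assoc, ← Finset.sum_add_distrib]
    refine add_le_add_right (Finset.sum_le_sum fun p _ => ?_) _
    have hp : (q - payoffStep G g κ m (m + s • z)) p = q p - (g * F p z + κ * m p) := by
      simp [payoffStep, hF]
    rw [hp]
    -- Only the square of the displacement is split by `(u + v) ^ 2 ≤ 2 * u ^ 2 + 2 * v ^ 2`; the
    -- terms linear in it stay exact, since their signs matter.
    nlinarith [sq_nonneg (g * F p z - κ * m p)]
  have hnn : ∀ z, 0 ≤ c + ∑ p, (2 * g ^ 2 * F p z ^ 2 - 2 * g * (q p * F p z)) := fun z =>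
    le_trans (by positivity) (hpt z)
  refine (lintegral_mono fun z => ENNReal.ofReal_le_ofReal (hpt z)).trans_eq ?_
  rw [← ofReal_integral_eq_lintegral_ofReal (f := fun z => c
      + ∑ p, (2 * g ^ 2 * F p z ^ 2 - 2 * g * (q p * F p z))) ((integrable_const c).add hints)
    (Eventually.of_forall hnn), integral_add (integrable_const c) hints,
    integral_finsetSum _ fun p _ => hintp p]
  congr 1
  simp only [integral_const, probReal_univ, one_smul]
  rw [hc, add_assoc]
  congr 2
  refine Finset.sum_congr rfl fun p _ => ?_
  rw [integral_sub ((hint2 p).const_mul _) (((hint1 p).const_mul _).const_mul _),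
    integral_const_mul, integral_const_mul, integral_const_mul]

/-! ### Drift of the Lyapunov function -/

section drift
variable {E : Type*} [NormedAddCommGroup E] [InnerProductSpace ℝ E]

theorem norm_excess_smul {R : ℝ} (hR : 0 ≤ R) (a m : E) :
    ‖excessFraction a R m • (m - a)‖ = max (‖m - a‖ - R) 0 := by
  rw [norm_smul, Real.norm_of_nonneg (excessFraction_nonneg m), excessFraction_mul_norm hR]

/-- Outside of the ball around `a` through the origin, the regularization points inwards. -/
theorem inner_excess_smul_nonneg (a m : E) :
    0 ≤ inner ℝ (excessFraction a ‖a‖ m • (m - a)) m := by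
  rw [real_inner_smul_left]
  rcases le_total ‖m - a‖ ‖a‖ with h | h
  · rw [excessFraction_eq_zero h, zero_mul]
  · refine mul_nonneg (excessFraction_nonneg m) ?_
    have h1 : inner ℝ (m - a) m = ‖m - a‖ ^ 2 + inner ℝ (m - a) a := by
      rw [← real_inner_self_eq_norm_sq, ← inner_add_right, sub_add_cancel]
    -- Cauchy–Schwarz: `⟪m - a, a⟫ ≥ -‖m - a‖ * ‖a‖ ≥ -‖m - a‖ ^ 2` in this case.
    have h2 := (abs_le.1 (abs_real_inner_le_norm (m - a) a)).1
    rw [h1]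
    nlinarith [norm_nonneg (m - a)]

/-- Turns growth in `m` into growth in the excess, and at the end boundedness of the excess into
boundedness of the means. -/
theorem norm_le_excess_add (a m : E) :
    ‖m‖ ≤ ‖excessFraction a ‖a‖ m • (m - a)‖ + 2 * ‖a‖ := by
  rw [norm_excess_smul (norm_nonneg a)]
  have h := norm_add_le (m - a) a
  rw [sub_add_cancel] at h
  linarith [le_max_left (‖m - a‖ - ‖a‖) 0]

end drift

/-- The second-order expansion of the excess over the ball around a solution `a` of the variational
inequality grows by a small factor only. -/
theorem excess_expansion_le {N d : ℕ} {G : ContinuousGame N d}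
    (hmono : MonotoneMappingOn G.gameMapping G.jointActions) {a m : JointSpace N d}
    (ha : a ∈ viSolutions G.jointActions G.gameMapping) (hm : m ∈ G.jointActions)
    {C T g s e : ℝ} (hg : 0 ≤ g) (he : 0 ≤ e) (hC : 0 ≤ C) (hT : s ^ 2 * e ≤ T)
    {I H : Fin N × Fin d → ℝ} (hI : ∀ p, |I p - s ^ 2 * G.gameMapping m p| ≤ C * s ^ 3)
    (hH : ∀ p, H p ≤ C * (1 + ‖m‖ ^ 2)) {q : JointSpace N d}
    (hq : q = excessFraction a ‖a‖ m • (m - a)) :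
    1 + (‖q‖ ^ 2 - 2 * (g * s ^ 2 * e) * inner ℝ q m + 2 * (g * s ^ 2 * e) ^ 2 * ‖m‖ ^ 2
        + ∑ p, (2 * g ^ 2 * H p - 2 * g * (q p * I p)))
      ≤ (1 + (2 * (N * d) * C * (g * s ^ 2 * s)
          + (2 * (N * d) * C + 2 * T ^ 2) * (2 + 8 * ‖a‖ ^ 2) * g ^ 2)) * (1 + ‖q‖ ^ 2) := by
  have hqm : 0 ≤ inner ℝ q m := hq ▸ inner_excess_smul_nonneg a m
  have hqM : 0 ≤ ∑ p, q p * G.gameMapping m p := by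
    -- Monotonicity compares the mapping at `m` with its value at `a`, where the variational
    -- inequality gives the sign.
    have h1 : (0 : ℝ) ≤ inner ℝ (G.gameMapping m) (m - a) := by
      have h2 := hmono m hm a ha.1
      have h3 := ha.2 m hm
      rw [inner_sub_left] at h2
      linarith
    have h4 : ∑ p, q p * G.gameMapping m p = inner ℝ (G.gameMapping m) q := by
      simp [PiLp.inner_apply]
    rw [h4, hq, real_inner_smul_right]
    exact mul_nonneg (excessFraction_nonneg m) h1
  -- From `‖m‖ ^ 2 ≤ 2 * ‖q‖ ^ 2 + 8 * ‖a‖ ^ 2`. The `1` in the Lyapunov function absorbs the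
  -- constants, so no additive error is left.
  have hm2 : 1 + ‖m‖ ^ 2 ≤ (2 + 8 * ‖a‖ ^ 2) * (1 + ‖q‖ ^ 2) := by
    have h1 : ‖m‖ ≤ ‖q‖ + 2 * ‖a‖ := hq ▸ norm_le_excess_add a m
    have h2 : ‖m‖ ^ 2 ≤ (‖q‖ + 2 * ‖a‖) ^ 2 := by gcongr
    nlinarith [sq_nonneg (‖q‖ - 2 * ‖a‖), mul_nonneg (sq_nonneg ‖a‖) (sq_nonneg ‖q‖)]
  have hterm : ∀ p, 2 * g ^ 2 * H p - 2 * g * (q p * I p)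
      ≤ (2 * g ^ 2 * (C * ((2 + 8 * ‖a‖ ^ 2) * (1 + ‖q‖ ^ 2)))
          + 2 * g * ((1 + ‖q‖ ^ 2) * (C * s ^ 3)))
        - 2 * g * s ^ 2 * (q p * G.gameMapping m p) := by
    intro p
    have h1 : 2 * g ^ 2 * H p ≤ 2 * g ^ 2 * (C * ((2 + 8 * ‖a‖ ^ 2) * (1 + ‖q‖ ^ 2))) := by
      gcongr
      exact (hH p).trans (by gcongr)
    have h2 : |q p| ≤ 1 + ‖q‖ ^ 2 := by
      have h3 : |q p| ≤ ‖q‖ := PiLp.norm_apply_le q p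
      nlinarith [sq_nonneg (‖q‖ - 1), norm_nonneg q]
    have h4 : |q p * (I p - s ^ 2 * G.gameMapping m p)| ≤ (1 + ‖q‖ ^ 2) * (C * s ^ 3) := by
      rw [abs_mul]
      exact mul_le_mul h2 (hI p) (abs_nonneg _) (by positivity)
    have h5 := mul_le_mul_of_nonneg_left (neg_le_of_abs_le h4) (by positivity : 0 ≤ 2 * g)
    linarith
  have hsum : ∑ p, (2 * g ^ 2 * H p - 2 * g * (q p * I p))
      ≤ N * d * (2 * g ^ 2 * (C * ((2 + 8 * ‖a‖ ^ 2) * (1 + ‖q‖ ^ 2)))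
          + 2 * g * ((1 + ‖q‖ ^ 2) * (C * s ^ 3)))
        - 2 * g * s ^ 2 * ∑ p, q p * G.gameMapping m p := by
    refine (Finset.sum_le_sum fun p _ => hterm p).trans_eq ?_
    rw [Finset.sum_sub_distrib, ← Finset.mul_sum, Finset.sum_const, Finset.card_univ,
      Fintype.card_prod, Fintype.card_fin, Fintype.card_fin, nsmul_eq_mul, Nat.cast_mul]
  have hκ : 2 * (g * s ^ 2 * e) ^ 2 * ‖m‖ ^ 2
      ≤ 2 * T ^ 2 * g ^ 2 * ((2 + 8 * ‖a‖ ^ 2) * (1 + ‖q‖ ^ 2)) := by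
    -- Since `s ^ 2 * e ≤ T`, the second-order effect of the regularization is charged to `g ^ 2`.
    have h1 : (g * s ^ 2 * e) ^ 2 ≤ T ^ 2 * g ^ 2 := by
      rw [show g * s ^ 2 * e = s ^ 2 * e * g by ring, mul_pow]
      gcongr
    have h2 : ‖m‖ ^ 2 ≤ (2 + 8 * ‖a‖ ^ 2) * (1 + ‖q‖ ^ 2) := by linarith
    calc _ = 2 * ((g * s ^ 2 * e) ^ 2 * ‖m‖ ^ 2) := by ring
      _ ≤ 2 * (T ^ 2 * g ^ 2 * ((2 + 8 * ‖a‖ ^ 2) * (1 + ‖q‖ ^ 2))) := by gcongr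
      _ = _ := by ring
  have h1 : 0 ≤ 2 * (g * s ^ 2 * e) * inner ℝ q m := by positivity
  have h2 : 0 ≤ 2 * g * s ^ 2 * ∑ p, q p * G.gameMapping m p := by positivity
  linarith

/-! ### Signs of the parameters and measurability -/

theorem StepSizeConditions.gamma_nonneg {a b c : ℝ} {γ σ ε : ℕ → ℝ}
    (h : StepSizeConditions a b c γ σ ε) (t : ℕ) : 0 ≤ γ t := by
  rcases Nat.eq_zero_or_pos t with rfl | ht
  · exact h.gamma_zero_pos.le
  · rw [h.gamma_eq t ht]; positivity

theorem StepSizeConditions.sigma_pos {a b c : ℝ} {γ σ ε : ℕ → ℝ}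
    (h : StepSizeConditions a b c γ σ ε) (t : ℕ) : 0 < σ t := by
  rcases Nat.eq_zero_or_pos t with rfl | ht
  · exact h.sigma_zero_pos
  · rw [h.sigma_eq t ht]; positivity

theorem StepSizeConditions.eps_nonneg {a b c : ℝ} {γ σ ε : ℕ → ℝ}
    (h : StepSizeConditions a b c γ σ ε) (t : ℕ) : 0 ≤ ε t := by
  rcases Nat.eq_zero_or_pos t with rfl | ht
  · exact h.eps_zero_pos.le
  · rw [h.eps_eq t ht]; positivity

theorem measurable_payoffStep {N d : ℕ} {G : ContinuousGame N d} (hJ : ∀ i, Continuous (G.J i))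
    (g κ : ℝ) :
    Measurable fun y : JointSpace N d × JointSpace N d => payoffStep G g κ y.1 y.2 := by
  refine (WithLp.measurable_toLp 2 _).comp (measurable_pi_lambda _ fun p => ?_)
  have := hJ p.1
  fun_prop

theorem measurable_excess_smul {E : Type*} [NormedAddCommGroup E] [NormedSpace ℝ E]
    [MeasurableSpace E] [BorelSpace E] [SecondCountableTopology E] (a : E) (R : ℝ) :
    Measurable fun m : E => excessFraction a R m • (m - a) := by
  unfold excessFraction
  fun_prop

/-! ### Almost sure boundedness of the means -/

theorem lemma3 {N d : ℕ} (G : ContinuousGame N d)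
    -- the action sets are closed and convex, and the cost functions are differentiable
    (hA_closed : ∀ i, IsClosed (G.A i)) (hA_convex : ∀ i, Convex ℝ (G.A i))
    (hJ : ∀ i, Differentiable ℝ (G.J i))
    -- the game mapping is monotone on the set of joint actions
    (hmono : MonotoneMappingOn G.gameMapping G.jointActions)
    -- the variational inequality has a solution
    (hsol : (viSolutions G.jointActions G.gameMapping).Nonempty)
    -- each component of the game mapping is Lipschitz continuous
    (hlip : ∀ i, ∃ L : NNReal, LipschitzWith L (fun a => block (G.gameMapping a) i))
    -- the cost functions grow at most linearly
    (hgrowth : ∀ i, GrowsAtMostLinearly (G.J i))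
    -- the parameters of the algorithm
    (a b c : ℝ) (γ σ ε : ℕ → ℝ) (hstep : StepSizeConditions a b c γ σ ε)
    -- a run of the algorithm from an arbitrary initial mean
    (μ₀ : JointSpace N d) {Ω : Type*} [MeasurableSpace Ω] (P : Measure Ω) [IsProbabilityMeasure P]
    (x μ : ℕ → Ω → JointSpace N d) (hrun : IsPayoffBasedRun G γ σ ε μ₀ P x μ) :
    P {ω | BddAbove (Set.range fun t => ‖μ t ω‖)} = 1 := by
  obtain ⟨aS, ha'⟩ := hsol
  obtain ⟨S, hS⟩ := hstep.tendsto_sigma.bddAbove_range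
  obtain ⟨e₀, he₀⟩ := hstep.tendsto_eps.bddAbove_range
  have hσS : ∀ t, σ t ≤ S := fun t => hS ⟨t, rfl⟩
  have hεe : ∀ t, ε t ≤ e₀ := fun t => he₀ ⟨t, rfl⟩
  have hσ := hstep.sigma_pos
  have hγ := hstep.gamma_nonneg
  have hε := hstep.eps_nonneg
  have hT : ∀ t, σ t ^ 2 * ε t ≤ S ^ 2 * e₀ := fun t =>
    mul_le_mul (pow_le_pow_left₀ (hσ t).le (hσS t) 2) (hεe t) (hε t) (sq_nonneg S)
  obtain ⟨C, hC, hest⟩ := exists_gradient_estimate_bounds hJ hlip hgrowth S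
  -- the part of a mean outside of the ball around the solution
  let q : JointSpace N d → JointSpace N d := fun m => excessFraction aS ‖aS‖ m • (m - aS)
  have hqm : Measurable q := measurable_excess_smul aS ‖aS‖
  let κ : ℕ → ℝ := fun t => γ t * σ t ^ 2 * ε t
  let θ : ℕ → ℝ := fun t => 2 * (N * d) * C * (γ t * σ t ^ 2 * σ t)
    + (2 * (N * d) * C + 2 * (S ^ 2 * e₀) ^ 2) * (2 + 8 * ‖aS‖ ^ 2) * γ t ^ 2
  have hθ0 : ∀ t, 0 ≤ θ t := fun t => by
    have := hγ t
    have := (hσ t).le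
    positivity
  have hθs : Summable θ :=
    (hstep.summable_beta_sigma.mul_left _).add (hstep.summable_gamma_sq.mul_left _)
  have hpsm : ∀ t, Measurable fun y : JointSpace N d × JointSpace N d =>
      payoffStep G (γ t) (κ t) y.1 y.2 := fun t =>
    measurable_payoffStep (fun i => (hJ i).continuous) _ _
  -- The excess is the distance to the ball, hence at most the distance to any `w` in it; if `w` is
  -- a joint action, the projection does not increase that distance.
  have hD : ∀ t ω, ∀ w : JointSpace N d, w ∈ G.jointActions → ‖w - aS‖ ≤ ‖aS‖ →
      ‖q (μ (t + 1) ω)‖ ≤ ‖μ t ω - w - payoffStep G (γ t) (κ t) (μ t ω) (x t ω)‖ := by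
    intro t ω w hw hwa
    refine le_trans ?_ (hrun.norm_mean_succ_sub_le hA_convex (hσ t).ne' ω hw)
    rw [norm_excess_smul (norm_nonneg _)]
    refine max_le ?_ (norm_nonneg _)
    linarith [norm_sub_le_norm_sub_add_norm_sub (μ (t + 1) ω) w aS]
  -- Index `n` stands for time `n + 1`: the initial mean need not be a joint action, all later means
  -- are.
  let ℱ : Filtration ℕ ‹MeasurableSpace Ω› :=
    { seq := fun n => history x μ (n + 1)
      mono' := fun i j h => history_mono x μ (Nat.succ_le_succ h)
      le' := fun n => history_le hrun.measurable_state hrun.measurable_mean (n + 1) }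
  have hbdd : ∀ᵐ ω ∂P, BddAbove (Set.range fun n => 1 + ‖q (μ (n + 1) ω)‖ ^ 2) := by
    refine ae_bddAbove_of_setLIntegral_succ_le ℱ (θ := fun n => θ (n + 1)) ?_ ?_ ?_
      (fun n => hθ0 _) ((summable_nat_add_iff 1).2 hθs) ?_
    · intro n
      exact ((hqm.norm.pow_const 2).const_add 1).comp (measurable_mean_history x μ (n + 1))
    · intro n ω; positivity
    -- Only finiteness is needed for the first step, so `w = aS` suffices; the expectation is finite
    -- because `μ 0` is deterministic.
    · have hle : ∀ ω, ENNReal.ofReal (1 + ‖q (μ (0 + 1) ω)‖ ^ 2) ≤ ENNReal.ofReal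
          (1 + ‖μ 0 ω - aS - payoffStep G (γ 0) (κ 0) (μ 0 ω) (x 0 ω)‖ ^ 2) := fun ω => by
        have := hD 0 ω aS ha'.1 (by simp)
        gcongr
      refine ne_top_of_le_ne_top ?_ (lintegral_mono hle)
      have h := hrun.setLIntegral_eq 0 MeasurableSet.univ
        (F := fun y => ENNReal.ofReal (1 + ‖y.1 - aS - payoffStep G (γ 0) (κ 0) y.1 y.2‖ ^ 2))
        (by have := hpsm 0; fun_prop)
      simp only [Measure.restrict_univ, hrun.init] at h ⊢
      rw [h, lintegral_const]
      refine ENNReal.mul_ne_top (ne_top_of_le_ne_top ENNReal.ofReal_ne_top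
        (lintegral_norm_sub_payoffStep_sq_le (γ 0) (κ 0) (σ 0) (μ₀ - aS) μ₀
          fun p => (hest p μ₀ (σ 0) (hσ 0).le (hσS 0)).1)) (by simp)
    · intro n s hs
      have hle : ∀ ω, ENNReal.ofReal (1 + ‖q (μ (n + 1 + 1) ω)‖ ^ 2) ≤ ENNReal.ofReal
          (1 + ‖q (μ (n + 1) ω)
            - payoffStep G (γ (n + 1)) (κ (n + 1)) (μ (n + 1) ω) (x (n + 1) ω)‖ ^ 2) := fun ω => by
        -- With the retraction of the mean as `w`, the difference of mean and `w` is exactly its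
        -- excess.
        have := hD (n + 1) ω (μ (n + 1) ω - q (μ (n + 1) ω))
          (retraction_mem (convex_jointActions hA_convex) (norm_nonneg _) ha'.1
            (mem_jointActions_mean_succ hrun n ω))
          (norm_retraction_sub_le (norm_nonneg _) _)
        rw [sub_sub_cancel] at this
        gcongr
      refine (lintegral_mono hle).trans ?_
      rw [hrun.setLIntegral_eq (n + 1) hs (F := fun y => ENNReal.ofReal
          (1 + ‖q y.1 - payoffStep G (γ (n + 1)) (κ (n + 1)) y.1 y.2‖ ^ 2))
        (by have := hpsm (n + 1); fun_prop), ← lintegral_const_mul' _ _ ENNReal.ofReal_ne_top]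
      refine lintegral_mono fun ω => ?_
      have hest' := fun p => hest p (μ (n + 1) ω) (σ (n + 1)) (hσ _).le (hσS _)
      refine (lintegral_norm_sub_payoffStep_sq_le (γ (n + 1)) (κ (n + 1)) (σ (n + 1))
        (q (μ (n + 1) ω)) (μ (n + 1) ω) fun p => (hest' p).1).trans ?_
      rw [← ENNReal.ofReal_mul (by linarith [hθ0 (n + 1)])]
      refine ENNReal.ofReal_le_ofReal ?_
      exact excess_expansion_le hmono ha' (mem_jointActions_mean_succ hrun n ω) (hγ _) (hε _)
        hC (hT _) (fun p => (hest' p).2.1) (fun p => (hest' p).2.2) rfl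
  refine (measure_congr (eventuallyEq_univ.2 ?_)).trans measure_univ
  filter_upwards [hbdd] with ω hω
  obtain ⟨B, hB⟩ := hω
  refine ⟨max ‖μ 0 ω‖ (B + 2 * ‖aS‖), ?_⟩
  rintro _ ⟨t, rfl⟩
  rcases t with _ | n
  · exact le_max_left _ _
  · refine le_trans ?_ (le_max_right _ _)
    have h1 : 1 + ‖q (μ (n + 1) ω)‖ ^ 2 ≤ B := hB ⟨n, rfl⟩
    have h2 : ‖μ (n + 1) ω‖ ≤ ‖q (μ (n + 1) ω)‖ + 2 * ‖aS‖ := norm_le_excess_add aS _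
    nlinarith [sq_nonneg (‖q (μ (n + 1) ω)‖ - 1), norm_nonneg (q (μ (n + 1) ω))]
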